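/- Let $\Omega$ be a locally compact topological space (every point has a compact neighbourhood), and let $C_0(\Omega)$ be the Banach algebra of continuous functions $f\colon\Omega\to\mathbb{C}$ vanishing at infinity, with pointwise operations and the supremum norm. Then $C_0(\Omega)$ is a hyper-Tauberian algebra. Here a commutative complex Banach algebra $A$, with space $\Phi_A$ of nonzero characters in the weak-$*$ topology, is called hyper-Tauberian if it is semisimple ($a\in A$ and $t(a)=0$ for all $t\in\Phi_A$ imply $a=0$), regular (for every closed $F\subseteq\Phi_A$ and $t\in\Phi_A\setminus F$ there is $a\in A$ with $t(a)=1$ and $s(a)=0$ for all $s\in F$), and every bounded linear local operator $T\colon A\to A^*$ is a multiplier, i.e. $T(ab)=a\cdot T(b)$ for all $a,b\in A$. The dual $A^*$ carries the module action $\langle a\cdot\varphi,x\rangle=\langle\varphi,xa\rangle$. For an element $x$ of a Banach $A$-module, its support is $\operatorname{supp}x=\{t\in\Phi_A : t(a)=0 \text{ for all } a\in A \text{ with } ax=0\}$. The operator $T$ is local if $\operatorname{supp}T(a)\subseteq\operatorname{supp}a$ for all $a\in A$, where $A$ acts on itself by multiplication. -/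

import Mathlib

open scoped ZeroAtInfty

noncomputable section

namespace HyperTauberian

/-! ### Banach modules, hulls, supports and local operators

Here `A` is a complex commutative Banach algebra, not necessarily unital. Its carrier space is
Mathlib's `WeakDual.characterSpace ℂ A`, the nonzero multiplicative functionals with the weak-star
(Gelfand) topology. The action of `A` on a module `X` is recorded as a bounded bilinear map. -/

section Module

variable {A : Type*} [NonUnitalNormedCommRing A] [NormedSpace ℂ A] [IsScalarTower ℂ A A]
  [SMulCommClass ℂ A A]
variable {X : Type*} [NormedAddCommGroup X] [NormedSpace ℂ X]
variable {Y : Type*} [NormedAddCommGroup Y] [NormedSpace ℂ Y]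

/-- The hull of a subset of `A`: the set of characters vanishing on it. -/
def hull (I : Set A) : Set (WeakDual.characterSpace ℂ A) :=
  {t | ∀ a ∈ I, t a = 0}

/-- The annihilator in `A` of an element `x` of a module. -/
def ann (act : A →L[ℂ] X →L[ℂ] X) (x : X) : Set A :=
  {a | act a x = 0}

/-- The support of `x` in the carrier space: the hull of its annihilator. -/
def supp (act : A →L[ℂ] X →L[ℂ] X) (x : X) : Set (WeakDual.characterSpace ℂ A) :=
  hull (ann act x)

/-- An operator is local if it does not enlarge supports. -/
def IsLocal (actX : A →L[ℂ] X →L[ℂ] X) (actY : A →L[ℂ] Y →L[ℂ] Y) (T : X →ₗ[ℂ] Y) : Prop :=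
  ∀ x : X, supp actY (T x) ⊆ supp actX x

/-- An operator from `A` into a module is a multiplier if `T (a * b) = a • T b`. -/
def IsMultiplier (act : A →L[ℂ] X →L[ℂ] X) (T : A →ₗ[ℂ] X) : Prop :=
  ∀ a b : A, T (a * b) = act a (T b)

end Module

section Algebra

variable (A : Type*) [NonUnitalNormedCommRing A] [NormedSpace ℂ A] [IsScalarTower ℂ A A]
  [SMulCommClass ℂ A A]

/-- `A` acting on itself by multiplication. -/
def selfAction : A →L[ℂ] A →L[ℂ] A :=
  ContinuousLinearMap.mul ℂ A

/-- The action of `A` on its Banach space dual, `(a • φ) x = φ (x * a)`. -/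
def dualAction : A →L[ℂ] StrongDual ℂ A →L[ℂ] StrongDual ℂ A :=
  (ContinuousLinearMap.compL ℂ A A ℂ).flip.comp (ContinuousLinearMap.mul ℂ A).flip

theorem selfAction_apply (a b : A) : selfAction A a b = a * b := rfl

theorem dualAction_apply (a : A) (φ : StrongDual ℂ A) (x : A) :
    dualAction A a φ x = φ (x * a) := rfl

/-- `A` is semisimple: the characters separate the points of `A`. -/
def IsSemisimpleBanach : Prop :=
  ∀ a : A, (∀ t : WeakDual.characterSpace ℂ A, t a = 0) → a = 0

/-- `A` is regular: its elements separate points from closed sets in the carrier space. -/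
def IsRegularBanach : Prop :=
  ∀ F : Set (WeakDual.characterSpace ℂ A), IsClosed F → ∀ t ∉ F,
    ∃ a : A, t a = 1 ∧ ∀ s ∈ F, s a = 0

/-- A commutative, regular, semisimple Banach algebra is hyper-Tauberian if every bounded local
operator from it into its dual is a multiplier. -/
structure IsHyperTauberian [CompleteSpace A] : Prop where
  semisimple : IsSemisimpleBanach A
  regular : IsRegularBanach A
  multiplier_of_local : ∀ T : A →L[ℂ] StrongDual ℂ A,
    IsLocal (selfAction A) (dualAction A) (T : A →ₗ[ℂ] StrongDual ℂ A) →
      IsMultiplier (dualAction A) (T : A →ₗ[ℂ] StrongDual ℂ A)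

end Algebra

end HyperTauberian

end

open scoped BoundedContinuousFunction

noncomputable section

namespace HyperTauberian

/-! If `a * b = 0`, then `b` annihilates `a`, so it is killed by every character in `supp a`, hence
in `supp (T a)`. A compactness argument then gives `T a b = 0` (`apply_eq_zero_of_isLocal`). It
remains to see that a bounded form vanishing on orthogonal pairs satisfies `T (F x) y = T x (F y)`
for bounded continuous `F` (`balanceDefect_eq_zero`); `F = a` is then the multiplier identity. This
is immediate when `F` takes only the values 0 and 1 off the zeros of `x`. After splitting `x` in
two, a real `F ≥ 0` is within 1 of sums of such functions, so the defect has a bound independent of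
`F`; being linear in `F`, it vanishes by scaling. Characters are never identified with points of
`Ω`: it is enough that each `t` is concentrated where `a` is close to `t a`
(`character_boundedMul_eq_zero`). -/

/-- Bounded operators from `A` into its dual, or bounded bilinear forms on `A`. -/
abbrev DualOperator (A : Type*) [NonUnitalNormedCommRing A] [NormedSpace ℂ A] : Type _ :=
  A →L[ℂ] StrongDual ℂ A

/-- An operator into the dual is local if it does not enlarge supports. -/
def DualOperator.IsLocal {A : Type*} [NonUnitalNormedCommRing A] [NormedSpace ℂ A]
    [IsScalarTower ℂ A A] [SMulCommClass ℂ A A] (T : DualOperator A) : Prop :=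
  HyperTauberian.IsLocal (selfAction A) (dualAction A) (T : A →ₗ[ℂ] StrongDual ℂ A)

/-! ### Multiplication by bounded continuous functions -/

variable {Ω : Type*} [TopologicalSpace Ω]

/-- Bounded continuous functions act on functions vanishing at infinity by multiplication. -/
def boundedMul : (Ω →ᵇ ℂ) →ₗ[ℂ] C₀(Ω, ℂ) →ₗ[ℂ] C₀(Ω, ℂ) :=
  LinearMap.mk₂ ℂ
    (fun F b =>
      { toFun := fun ω => F ω * b ω
        continuous_toFun := F.continuous.mul b.continuous
        zero_at_infty' := by
          refine squeeze_zero_norm (a := fun ω => ‖F‖ * ‖b ω‖) (fun ω => ?_) ?_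
          · rw [norm_mul]
            exact mul_le_mul_of_nonneg_right (F.norm_coe_le_norm ω) (norm_nonneg _)
          · simpa using (b.zero_at_infty'.norm).const_mul ‖F‖ })
    (fun F G b => by ext ω; exact add_mul (F ω) (G ω) (b ω))
    (fun c F b => by ext ω; exact mul_assoc c (F ω) (b ω))
    (fun F b c => by ext ω; exact mul_add (F ω) (b ω) (c ω))
    (fun c F b => by ext ω; exact mul_left_comm (F ω) c (b ω))

@[simp]
theorem boundedMul_apply (F : Ω →ᵇ ℂ) (b : C₀(Ω, ℂ)) (ω : Ω) :
    boundedMul F b ω = F ω * b ω := rfl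

theorem norm_apply_le_norm (b : C₀(Ω, ℂ)) (ω : Ω) : ‖b ω‖ ≤ ‖b‖ :=
  b.toBCF.norm_coe_le_norm ω

theorem norm_le_of_forall_apply {b : C₀(Ω, ℂ)} {C : ℝ} (hC : 0 ≤ C) (h : ∀ ω, ‖b ω‖ ≤ C) :
    ‖b‖ ≤ C :=
  (BoundedContinuousFunction.norm_le (f := b.toBCF) hC).2 h

theorem norm_boundedMul_le (F : Ω →ᵇ ℂ) (b : C₀(Ω, ℂ)) : ‖boundedMul F b‖ ≤ ‖F‖ * ‖b‖ := by
  refine norm_le_of_forall_apply (by positivity) fun ω => ?_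
  rw [boundedMul_apply, norm_mul]
  exact mul_le_mul (F.norm_coe_le_norm ω) (norm_apply_le_norm b ω) (norm_nonneg _) (norm_nonneg _)

@[simp]
theorem boundedMul_one (b : C₀(Ω, ℂ)) : boundedMul 1 b = b := by
  ext ω
  simp

/-- Evaluation at a point as an additive map. -/
def evalAddMonoidHom (ω : Ω) : C₀(Ω, ℂ) →+ ℂ where
  toFun b := b ω
  map_zero' := rfl
  map_add' _ _ := rfl

/-! ### Characters of `C₀(Ω, ℂ)` -/

/-- Evaluation at a point where some function does not vanish is a character. -/
def evalCharacter (ω : Ω) (h : ∃ b : C₀(Ω, ℂ), b ω ≠ 0) :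
    WeakDual.characterSpace ℂ C₀(Ω, ℂ) :=
  ⟨StrongDual.toWeakDual (LinearMap.mkContinuous
      { toFun := fun b : C₀(Ω, ℂ) => b ω
        map_add' := fun _ _ => rfl
        map_smul' := fun _ _ => rfl } 1
      (fun b => by simpa using norm_apply_le_norm b ω)),
    by
      obtain ⟨b, hb⟩ := h
      exact ⟨fun h0 => hb (DFunLike.congr_fun h0 b), fun _ _ => rfl⟩⟩

theorem isSemisimpleBanach_zeroAtInfty : IsSemisimpleBanach C₀(Ω, ℂ) := by
  intro a ha
  ext ω
  by_contra h
  exact h (ha (evalCharacter ω ⟨a, h⟩))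

/-- A character kills `F * e` if `F` vanishes where `a` is close to its value at the character. -/
theorem character_boundedMul_eq_zero (t : WeakDual.characterSpace ℂ C₀(Ω, ℂ)) (a e : C₀(Ω, ℂ))
    (F : Ω →ᵇ ℂ) {ε : ℝ} (hε : 0 < ε) (hF : ∀ ω, ‖a ω - t a‖ < ε → F ω = 0) :
    t (boundedMul F e) = 0 := by
  have hpos : ∀ ω, 0 < max ‖a ω - t a‖ ε := fun ω => lt_max_of_lt_right hε
  -- `k` is `F / (a - t a)`; the `max` keeps the denominator away from 0 and changes nothing where
  -- `F ≠ 0`.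
  let k : Ω →ᵇ ℂ := BoundedContinuousFunction.ofNormedAddCommGroup
    (fun ω => F ω * (star (a ω - t a) / ((max ‖a ω - t a‖ ε : ℝ) : ℂ) ^ 2))
    (by
      refine F.continuous.mul (Continuous.div ?_ ?_ fun ω => ?_)
      · have := a.continuous
        fun_prop
      · have := a.continuous
        fun_prop
      · have := (hpos ω).ne'
        exact pow_ne_zero _ (by exact_mod_cast this))
    (‖F‖ * ε⁻¹)
    (fun ω => by
      rw [norm_mul]
      refine mul_le_mul (F.norm_coe_le_norm ω) ?_ (norm_nonneg _) (norm_nonneg _)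
      rw [norm_div, norm_star, norm_pow, Complex.norm_real, Real.norm_of_nonneg (hpos ω).le,
        div_le_iff₀ (pow_pos (hpos ω) 2), sq, ← mul_assoc]
      have h1 : 1 ≤ ε⁻¹ * max ‖a ω - t a‖ ε := by
        rw [inv_mul_eq_div, one_le_div hε]
        exact le_max_right _ _
      nlinarith [le_max_left ‖a ω - t a‖ ε, hpos ω])
  have key : boundedMul F e = boundedMul k e * a - t a • boundedMul k e := by
    ext ω
    change F ω * e ω = F ω * (star (a ω - t a) / ((max ‖a ω - t a‖ ε : ℝ) : ℂ) ^ 2) * e ω * a ω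
      - t a * (F ω * (star (a ω - t a) / ((max ‖a ω - t a‖ ε : ℝ) : ℂ) ^ 2) * e ω)
    by_cases hω : ‖a ω - t a‖ < ε
    · simp [hF ω hω]
    · rw [max_eq_left (not_lt.1 hω)]
      have hne : a ω - t a ≠ 0 := norm_pos_iff.1 (hε.trans_le (not_lt.1 hω))
      have hq : star (a ω - t a) / ((‖a ω - t a‖ : ℝ) : ℂ) ^ 2 * (a ω - t a) = 1 := by
        rw [← Complex.conj_mul', div_mul_eq_mul_div]
        exact div_self (mul_ne_zero (star_ne_zero.2 hne) hne)
      linear_combination -(F ω * e ω) * hq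
  rw [key, map_sub, map_mul, map_smul, smul_eq_mul, mul_comm, sub_self]

theorem exists_character_ne_zero (t : WeakDual.characterSpace ℂ C₀(Ω, ℂ)) : ∃ e, t e ≠ 0 := by
  by_contra! h
  exact t.2.1 (DFunLike.ext _ _ h)

/-- If `‖a‖ < ‖t a‖`, then `a` stays away from `t a` on all of `Ω`, so `F = 1` is admissible in
`character_boundedMul_eq_zero` and `t = 0`. -/
theorem norm_character_apply_le (t : WeakDual.characterSpace ℂ C₀(Ω, ℂ)) (a : C₀(Ω, ℂ)) :
    ‖t a‖ ≤ ‖a‖ := by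
  by_contra! h
  obtain ⟨e, he⟩ := exists_character_ne_zero t
  refine he ?_
  rw [← boundedMul_one e]
  refine character_boundedMul_eq_zero t a e 1 (sub_pos.2 h) fun ω hω => ?_
  have h1 := norm_sub_norm_le (t a) (a ω)
  rw [norm_sub_rev] at h1
  linarith [norm_apply_le_norm a ω]

/-- Banach–Alaoglu: the characters together with 0 are a weak-star closed part of the unit ball, and
`r > 0` excludes 0. -/
theorem isCompact_setOf_le_norm_apply (b : C₀(Ω, ℂ)) {r : ℝ} (hr : 0 < r) :
    IsCompact {t : WeakDual.characterSpace ℂ C₀(Ω, ℂ) | r ≤ ‖t b‖} := by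
  rw [Topology.IsInducing.subtypeVal.isCompact_iff]
  have hcl : IsClosed {φ : WeakDual ℂ C₀(Ω, ℂ) | r ≤ ‖φ b‖} :=
    isClosed_le continuous_const (WeakDual.eval_continuous b).norm
  convert ((WeakDual.isCompact_closedBall (𝕜 := ℂ) (E := C₀(Ω, ℂ)) 0 1).inter_right
    (WeakDual.CharacterSpace.union_zero_isClosed (𝕜 := ℂ) (A := C₀(Ω, ℂ)))).inter_right hcl using 1
  ext φ
  constructor
  · rintro ⟨t, ht, rfl⟩
    refine ⟨⟨?_, Or.inl t.2⟩, ht⟩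
    rw [Set.mem_preimage, mem_closedBall_zero_iff]
    refine ContinuousLinearMap.opNorm_le_bound _ zero_le_one fun a => ?_
    rw [one_mul]
    exact norm_character_apply_le t a
  · rintro ⟨⟨-, hφ | hφ⟩, hb⟩
    · exact ⟨⟨φ, hφ⟩, hb, rfl⟩
    · rw [Set.mem_singleton_iff] at hφ
      subst hφ
      exact absurd (hb.trans_eq norm_zero) hr.not_ge

/-! ### Regularity -/

theorem exists_character_eq_one_of_mem_open (t : WeakDual.characterSpace ℂ C₀(Ω, ℂ))
    (a : C₀(Ω, ℂ)) {u : Set ℂ} (hu : IsOpen u) (ha : t a ∈ u) {e : C₀(Ω, ℂ)} (he : t e = 1) :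
    ∃ g : C₀(Ω, ℂ), t g = 1 ∧ ∀ s : WeakDual.characterSpace ℂ C₀(Ω, ℂ), s a ∉ u → s g = 0 := by
  obtain ⟨ε, hε, hball⟩ := Metric.isOpen_iff.1 hu _ ha
  -- `F` is 1 where `‖a - t a‖ ≤ ε / 3` and 0 where it is at least `2 * ε / 3`, which includes all
  -- points where `a` is within `ε / 3` of a value `s a ∉ u`.
  let F : Ω →ᵇ ℂ := BoundedContinuousFunction.ofNormedAddCommGroup
    (fun ω => ((max 0 (min 1 (2 - 3 / ε * ‖a ω - t a‖)) : ℝ) : ℂ))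
    (by
      have := a.continuous
      fun_prop)
    1
    (fun ω => by
      rw [Complex.norm_real, Real.norm_of_nonneg (le_max_left _ _)]
      exact max_le zero_le_one (min_le_left _ _))
  refine ⟨boundedMul F e, ?_, fun s hs => ?_⟩
  · have h := character_boundedMul_eq_zero t a e (1 - F) (ε := ε / 3) (by positivity)
      fun ω hω => by
        change (1 : ℂ) - ((max 0 (min 1 (2 - 3 / ε * ‖a ω - t a‖)) : ℝ) : ℂ) = 0
        have h1 : 3 / ε * ‖a ω - t a‖ ≤ 1 := by
          rw [div_mul_eq_mul_div, div_le_one hε]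
          linarith
        rw [min_eq_left (by linarith), max_eq_right zero_le_one]
        simp
    rw [map_sub, LinearMap.sub_apply, boundedMul_one, map_sub, he, sub_eq_zero] at h
    exact h.symm
  · refine character_boundedMul_eq_zero s a e F (ε := ε / 3) (by positivity) fun ω hω => ?_
    change ((max 0 (min 1 (2 - 3 / ε * ‖a ω - t a‖)) : ℝ) : ℂ) = 0
    have h1 : ε ≤ ‖s a - t a‖ := by
      by_contra! h
      exact hs (hball (by rwa [Metric.mem_ball, dist_eq_norm]))
    have h2 : ‖s a - t a‖ ≤ ‖a ω - s a‖ + ‖a ω - t a‖ := by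
      rw [norm_sub_rev (a ω) (s a)]
      exact norm_sub_le_norm_sub_add_norm_sub _ _ _
    have h3 : 2 ≤ 3 / ε * ‖a ω - t a‖ := by
      rw [div_mul_eq_mul_div, le_div_iff₀ hε]
      linarith
    rw [max_eq_left ((min_le_right _ _).trans (by linarith)), Complex.ofReal_zero]

theorem isRegularBanach_zeroAtInfty : IsRegularBanach C₀(Ω, ℂ) := by
  intro F hF t ht
  obtain ⟨e, he⟩ : ∃ e, t e = 1 := by
    obtain ⟨e, he⟩ := exists_character_ne_zero t
    exact ⟨(t e)⁻¹ • e, by rw [map_smul, smul_eq_mul, inv_mul_cancel₀ he]⟩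
  have hind : Topology.IsInducing
      (fun (s : WeakDual.characterSpace ℂ C₀(Ω, ℂ)) (a : C₀(Ω, ℂ)) => s a) :=
    (⟨rfl⟩ : Topology.IsInducing
      (fun (φ : WeakDual ℂ C₀(Ω, ℂ)) (a : C₀(Ω, ℂ)) => φ a)).comp .subtypeVal
  obtain ⟨V, hV, hVF⟩ := hind.isOpen_iff.1 hF.isOpen_compl
  have htV : (fun a => t a) ∈ V := by
    have : t ∈ Fᶜ := ht
    rwa [← hVF] at this
  obtain ⟨I, u, hu, hIV⟩ := isOpen_pi_iff.1 hV _ htV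
  -- A basic neighbourhood of `t` constrains finitely many `a`; multiply one function per
  -- constraint.
  suffices H : ∀ J ⊆ I, ∃ g : C₀(Ω, ℂ), t g = 1 ∧
      ∀ s : WeakDual.characterSpace ℂ C₀(Ω, ℂ), (∃ a ∈ J, s a ∉ u a) → s g = 0 by
    obtain ⟨g, hg1, hg⟩ := H I subset_rfl
    refine ⟨g, hg1, fun s hs => hg s ?_⟩
    by_contra! h
    have : s ∈ Fᶜ := by
      rw [← hVF]
      exact hIV fun a ha => h a ha
    exact this hs
  intro J
  classical
  induction J using Finset.induction_on with
  | empty => exact fun _ => ⟨e, he, by simp⟩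
  | insert a J _ ih =>
    intro hJ
    rw [Finset.insert_subset_iff] at hJ
    obtain ⟨g, hg1, hg⟩ := ih hJ.2
    obtain ⟨k, hk1, hk⟩ :=
      exists_character_eq_one_of_mem_open t a (hu a hJ.1).1 (hu a hJ.1).2 he
    refine ⟨k * g, by rw [map_mul, hk1, hg1, one_mul], ?_⟩
    rintro s ⟨b, hb, hsb⟩
    rw [map_mul]
    rcases Finset.mem_insert.1 hb with rfl | hb
    · rw [hk s hsb, zero_mul]
    · rw [hg s ⟨b, hb, hsb⟩, mul_zero]

/-! ### Local operators are orthogonality preserving -/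

/-- A functional vanishes on functions living on a set `|b| ≥ r` disjoint from its support. -/
theorem apply_eq_zero_of_supp {φ : StrongDual ℂ C₀(Ω, ℂ)} {b d : C₀(Ω, ℂ)} {r : ℝ} (hr : 0 < r)
    (hφ : ∀ t ∈ supp (dualAction C₀(Ω, ℂ)) φ, t b = 0) (hd : ∀ ω, d ω ≠ 0 → r ≤ ‖b ω‖) :
    φ d = 0 := by
  have hK := isCompact_setOf_le_norm_apply b hr
  have hc : ∀ t : WeakDual.characterSpace ℂ C₀(Ω, ℂ), r ≤ ‖t b‖ →
      ∃ c ∈ ann (dualAction C₀(Ω, ℂ)) φ, t c ≠ 0 := by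
    intro t ht
    by_contra! h
    rw [hφ t h, norm_zero] at ht
    exact hr.not_ge ht
  choose! c hc1 hc2 using hc
  have hev : ∀ x : C₀(Ω, ℂ),
      Continuous fun s : WeakDual.characterSpace ℂ C₀(Ω, ℂ) => s x := fun x =>
    (WeakDual.eval_continuous x).comp continuous_subtype_val
  obtain ⟨I, hI, hcov⟩ := hK.elim_nhds_subcover (fun t => {s | ‖t (c t)‖ / 2 < ‖s (c t)‖})
    fun t ht => (isOpen_lt continuous_const (hev (c t)).norm).mem_nhds
      (half_lt_self (norm_pos_iff.2 (hc2 t ht)))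
  obtain ⟨δ, hδ, hδI⟩ : ∃ δ > 0, ∀ t ∈ I, δ ≤ ‖t (c t)‖ / 2 := by
    clear hcov
    classical
    induction I using Finset.induction_on with
    | empty => exact ⟨1, one_pos, by simp⟩
    | insert t I _ ih =>
      obtain ⟨δ, hδ, h⟩ := ih fun x hx => hI x (Finset.mem_insert_of_mem hx)
      have ht := norm_pos_iff.2 (hc2 t (hI t (Finset.mem_insert_self t I)))
      refine ⟨min δ (‖t (c t)‖ / 2), lt_min hδ (half_pos ht), fun s hs => ?_⟩
      rcases Finset.mem_insert.1 hs with rfl | hs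
      · exact min_le_right _ _
      · exact (min_le_left _ _).trans (h s hs)
  let q : Ω → ℝ := fun ω => ∑ t ∈ I, ‖c t ω‖ ^ 2
  have hq : Continuous q := continuous_finsetSum _ fun t _ => ((c t).continuous.norm).pow 2
  have hqd : ∀ ω, d ω ≠ 0 → δ ^ 2 ≤ q ω := by
    intro ω hω
    have hb : r ≤ ‖b ω‖ := hd ω hω
    have hmem := hcov (show evalCharacter ω ⟨d, hω⟩ ∈ {t | r ≤ ‖t b‖} from hb)
    obtain ⟨t, ht, hlt⟩ := Set.mem_iUnion₂.1 hmem
    have hlt : ‖t (c t)‖ / 2 < ‖c t ω‖ := hlt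
    calc δ ^ 2 ≤ ‖c t ω‖ ^ 2 := pow_le_pow_left₀ hδ.le ((hδI t ht).trans hlt.le) 2
      _ ≤ q ω := Finset.single_le_sum (f := fun t => ‖c t ω‖ ^ 2) (fun _ _ => by positivity) ht
  have hpos : ∀ ω, 0 < max (q ω) (δ ^ 2) := fun ω => lt_max_of_lt_right (pow_pos hδ 2)
  let F : Ω →ᵇ ℂ := BoundedContinuousFunction.ofNormedAddCommGroup
    (fun ω => (((max (q ω) (δ ^ 2))⁻¹ : ℝ) : ℂ))
    (Complex.continuous_ofReal.comp
      ((hq.max continuous_const).inv₀ fun ω => (hpos ω).ne'))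
    ((δ ^ 2)⁻¹)
    (fun ω => by
      rw [Complex.norm_real, Real.norm_of_nonneg (inv_nonneg.2 (hpos ω).le)]
      exact inv_anti₀ (pow_pos hδ 2) (le_max_right _ _))
  -- Since `q = ∑ |c t|²` is at least `δ²` where `d ≠ 0`, dividing by it puts `d` in the ideal
  -- generated by the annihilators `c t` of `φ`.
  have key : d = ∑ t ∈ I, boundedMul F d * star (c t) * c t := by
    ext ω
    have hsum : (∑ t ∈ I, boundedMul F d * star (c t) * c t : C₀(Ω, ℂ)) ω =
        ∑ t ∈ I, F ω * d ω * star (c t ω) * c t ω := by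
      exact map_sum (evalAddMonoidHom ω) _ _
    have hsq : ∑ t ∈ I, star (c t ω) * c t ω = ((q ω : ℝ) : ℂ) := by
      simp only [q, Complex.ofReal_sum, Complex.ofReal_pow]
      exact Finset.sum_congr rfl fun t _ => Complex.conj_mul' _
    rw [hsum]
    simp only [mul_assoc]
    rw [← Finset.mul_sum, ← Finset.mul_sum, hsq]
    by_cases hω : d ω = 0
    · simp [hω]
    · change d ω = (((max (q ω) (δ ^ 2))⁻¹ : ℝ) : ℂ) * (d ω * ((q ω : ℝ) : ℂ))
      rw [max_eq_left (hqd ω hω)]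
      have hne : ((q ω : ℝ) : ℂ) ≠ 0 := by
        exact_mod_cast ((pow_pos hδ 2).trans_le (hqd ω hω)).ne'
      push_cast
      field_simp
  rw [key, map_sum]
  refine Finset.sum_eq_zero fun t ht => ?_
  rw [← dualAction_apply, show dualAction C₀(Ω, ℂ) (c t) φ = 0 from hc1 t (hI t ht)]
  rfl

theorem apply_eq_zero_of_isLocal {T : DualOperator C₀(Ω, ℂ)}
    (hT : DualOperator.IsLocal T)
    {a b : C₀(Ω, ℂ)} (hab : a * b = 0) : T a b = 0 := by
  have hb : ∀ t ∈ supp (dualAction C₀(Ω, ℂ)) (T a), t b = 0 := fun t ht =>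
    hT a ht b (show b * a = 0 by rw [mul_comm, hab])
  have hle : ∀ r > 0, ‖T a b‖ ≤ ‖T a‖ * (2 * r) := by
    intro r hr
    -- `F` is 0 where `‖b‖ ≤ r` and 1 where `‖b‖ ≥ 2 * r`, so `F * b` is within `2 * r` of `b`.
    let F : Ω →ᵇ ℂ := BoundedContinuousFunction.ofNormedAddCommGroup
      (fun ω => ((max 0 (min 1 (r⁻¹ * ‖b ω‖ - 1)) : ℝ) : ℂ))
      (by
        have := b.continuous
        fun_prop)
      1
      (fun ω => by
        rw [Complex.norm_real, Real.norm_of_nonneg (le_max_left _ _)]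
        exact max_le zero_le_one (min_le_left _ _))
    have h0 : T a (boundedMul F b) = 0 := by
      refine apply_eq_zero_of_supp hr hb fun ω hω => ?_
      by_contra! hlt
      refine hω ?_
      change ((max 0 (min 1 (r⁻¹ * ‖b ω‖ - 1)) : ℝ) : ℂ) * b ω = 0
      have : r⁻¹ * ‖b ω‖ ≤ 1 := by
        rw [inv_mul_le_iff₀ hr]
        linarith
      rw [max_eq_left ((min_le_right _ _).trans (by linarith)), Complex.ofReal_zero, zero_mul]
    rw [← sub_zero (T a b), ← h0, ← map_sub]
    refine (ContinuousLinearMap.le_opNorm _ _).trans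
      (mul_le_mul_of_nonneg_left ?_ (norm_nonneg _))
    refine norm_le_of_forall_apply (by positivity) fun ω => ?_
    set m : ℝ := max 0 (min 1 (r⁻¹ * ‖b ω‖ - 1)) with hm
    have hval : (b - boundedMul F b) ω = ((1 - m : ℝ) : ℂ) * b ω := by
      change b ω - ((m : ℝ) : ℂ) * b ω = _
      push_cast
      ring
    have hm1 : m ≤ 1 := max_le zero_le_one (min_le_left _ _)
    rw [hval, norm_mul, Complex.norm_real, Real.norm_of_nonneg (sub_nonneg.2 hm1)]
    rcases le_total (2 * r) ‖b ω‖ with h | h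
    · have : 1 ≤ r⁻¹ * ‖b ω‖ - 1 := by
        have : 2 ≤ r⁻¹ * ‖b ω‖ := by
          rw [inv_mul_eq_div, le_div_iff₀ hr]
          exact h
        linarith
      rw [hm, min_eq_left this, max_eq_right zero_le_one]
      simpa using hr.le
    · have hm0 : 0 ≤ m := le_max_left _ _
      nlinarith [norm_nonneg (b ω)]
  have hlim : Filter.Tendsto (fun r : ℝ => ‖T a‖ * (2 * r)) (nhdsWithin 0 (Set.Ioi 0)) (nhds 0) := by
    have : Continuous fun r : ℝ => ‖T a‖ * (2 * r) := by fun_prop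
    simpa using (this.tendsto 0).mono_left nhdsWithin_le_nhds
  exact norm_le_zero_iff.1 (ge_of_tendsto hlim (by
    filter_upwards [self_mem_nhdsWithin] with r hr using hle r hr))

/-! ### Orthogonality preserving forms are balanced -/

/-- The failure of the form `T x y` to be balanced with respect to multiplication by `F`. -/
def balanceDefect (T : DualOperator C₀(Ω, ℂ)) (x y : C₀(Ω, ℂ)) :
    (Ω →ᵇ ℂ) →ₗ[ℂ] ℂ :=
  (T.flip y).toLinearMap ∘ₗ boundedMul.flip x - (T x).toLinearMap ∘ₗ boundedMul.flip y

theorem balanceDefect_apply (T : DualOperator C₀(Ω, ℂ)) (x y : C₀(Ω, ℂ))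
    (F : Ω →ᵇ ℂ) : balanceDefect T x y F = T (boundedMul F x) y - T x (boundedMul F y) := rfl

theorem norm_balanceDefect_le (T : DualOperator C₀(Ω, ℂ)) (x y : C₀(Ω, ℂ))
    (F : Ω →ᵇ ℂ) : ‖balanceDefect T x y F‖ ≤ 2 * ‖F‖ * (‖T‖ * ‖x‖ * ‖y‖) := by
  rw [balanceDefect_apply]
  have h1 : ‖T (boundedMul F x) y‖ ≤ ‖T‖ * (‖F‖ * ‖x‖) * ‖y‖ :=
    (T.le_opNorm₂ _ _).trans (by gcongr; exact norm_boundedMul_le F x)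
  have h2 : ‖T x (boundedMul F y)‖ ≤ ‖T‖ * ‖x‖ * (‖F‖ * ‖y‖) :=
    (T.le_opNorm₂ _ _).trans (by gcongr; exact norm_boundedMul_le F y)
  linarith [norm_sub_le (T (boundedMul F x) y) (T x (boundedMul F y))]

variable {T : DualOperator C₀(Ω, ℂ)}

/-- The defect is `T (h x) ((1 - h) y) - T ((1 - h) x) (h y)`, and both pairs are orthogonal. -/
theorem balanceDefect_eq_zero_of_idempotent (hT : ∀ a b : C₀(Ω, ℂ), a * b = 0 → T a b = 0)
    (x y : C₀(Ω, ℂ)) (h : Ω →ᵇ ℂ) (hx : ∀ ω, h ω * (1 - h ω) * x ω = 0) :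
    balanceDefect T x y h = 0 := by
  have h1 : T (boundedMul h x) (y - boundedMul h y) = 0 := by
    refine hT _ _ ?_
    ext ω
    change h ω * x ω * (y ω - h ω * y ω) = 0
    linear_combination y ω * hx ω
  have h2 : T (x - boundedMul h x) (boundedMul h y) = 0 := by
    refine hT _ _ ?_
    ext ω
    change (x ω - h ω * x ω) * (h ω * y ω) = 0
    linear_combination y ω * hx ω
  rw [map_sub] at h1
  rw [map_sub, sub_apply] at h2
  rw [balanceDefect_apply]
  linear_combination h1 - h2

/-! ### Staircase approximation -/

/-- The continuous ramp from `0` to `1` of width `1 / 4` centred at the origin. -/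
def ramp (x : ℝ) : ℝ := max 0 (min 1 (4 * x + 1 / 2))

theorem continuous_ramp : Continuous ramp := by
  unfold ramp
  fun_prop

theorem ramp_nonneg (x : ℝ) : 0 ≤ ramp x := le_max_left _ _

theorem ramp_le_one (x : ℝ) : ramp x ≤ 1 := max_le zero_le_one (min_le_left _ _)

theorem ramp_mul_one_sub {x : ℝ} (hx : 1 / 8 ≤ |x|) : ramp x * (1 - ramp x) = 0 := by
  rcases le_abs.1 hx with h | h
  · rw [ramp, min_eq_left (by linarith), max_eq_right zero_le_one]
    norm_num
  · rw [ramp, max_eq_left ((min_le_right _ _).trans (by linarith)), zero_mul]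

theorem sum_clamp (x : ℝ) (N : ℕ) :
    ∑ k ∈ Finset.range N, max 0 (min 1 (x - k)) = max 0 (min (N : ℝ) x) := by
  induction N with
  | zero => simp
  | succ N ih =>
    rw [Finset.sum_range_succ, ih]
    push_cast
    have hN : (0 : ℝ) ≤ N := N.cast_nonneg
    grind

/-- Each ramp lies between the unit clamp and its shift by 1, whose sums telescope by `sum_clamp`.
-/
theorem abs_sub_sum_ramp_le {x s : ℝ} (hs0 : 0 ≤ s) (hs1 : s ≤ 1) {N : ℕ} (hx0 : 0 ≤ x)
    (hxN : x ≤ N) : |x - ∑ k ∈ Finset.range N, ramp (x - s - k)| ≤ 1 := by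
  have hlow : ∑ k ∈ Finset.range N, max 0 (min 1 (x - s - k)) ≤
      ∑ k ∈ Finset.range N, ramp (x - s - k) :=
    Finset.sum_le_sum fun k _ => by unfold ramp; grind
  have hup : ∑ k ∈ Finset.range N, ramp (x - s - k) ≤
      ∑ k ∈ Finset.range N, max 0 (min 1 (x - s + 1 - k)) :=
    Finset.sum_le_sum fun k _ => by unfold ramp; grind
  rw [sum_clamp] at hlow hup
  rw [abs_le]
  grind

/-- The ramp centred at `c`, evaluated on a continuous function. -/
def rampComp (f : C(Ω, ℝ)) (c : ℝ) : Ω →ᵇ ℂ :=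
  BoundedContinuousFunction.ofNormedAddCommGroup (fun ω => ((ramp (f ω - c) : ℝ) : ℂ))
    (Complex.continuous_ofReal.comp
      (continuous_ramp.comp (f.continuous.sub continuous_const)))
    1
    (fun ω => by
      rw [Complex.norm_real, Real.norm_of_nonneg (ramp_nonneg _)]
      exact ramp_le_one _)

theorem rampComp_apply (f : C(Ω, ℝ)) (c : ℝ) (ω : Ω) :
    rampComp f c ω = ((ramp (f ω - c) : ℝ) : ℂ) := rfl

/-- If `x` vanishes where `f` is close to `s + ℕ`, then `f` may be replaced by a staircase. -/
theorem norm_balanceDefect_le_of_vanishing (hT : ∀ a b : C₀(Ω, ℂ), a * b = 0 → T a b = 0)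
    (x y : C₀(Ω, ℂ)) (F : Ω →ᵇ ℂ) (f : C(Ω, ℝ)) (hFf : ∀ ω, F ω = (f ω : ℂ)) {N : ℕ}
    (hf0 : ∀ ω, 0 ≤ f ω) (hfN : ∀ ω, f ω ≤ N) {s : ℝ} (hs0 : 0 ≤ s) (hs1 : s ≤ 1)
    (hx : ∀ ω (k : ℕ), |f ω - s - k| < 1 / 8 → x ω = 0) :
    ‖balanceDefect T x y F‖ ≤ 2 * (‖T‖ * ‖x‖ * ‖y‖) := by
  set G : Ω →ᵇ ℂ := ∑ k ∈ Finset.range N, rampComp f (s + k) with hG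
  have hG0 : balanceDefect T x y G = 0 := by
    rw [hG, map_sum]
    refine Finset.sum_eq_zero fun k _ => balanceDefect_eq_zero_of_idempotent hT x y _ fun ω => ?_
    by_cases hω : |f ω - s - k| < 1 / 8
    · rw [hx ω k hω, mul_zero]
    · rw [rampComp_apply, ← sub_sub]
      have := ramp_mul_one_sub (not_lt.1 hω)
      rw [show ((ramp (f ω - s - k) : ℝ) : ℂ) * (1 - ((ramp (f ω - s - k) : ℝ) : ℂ)) = 0 by
        exact_mod_cast this, zero_mul]
  have hFG : ‖F - G‖ ≤ 1 := by
    refine (BoundedContinuousFunction.norm_le zero_le_one).2 fun ω => ?_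
    have hval : (F - G) ω = ((f ω - ∑ k ∈ Finset.range N, ramp (f ω - s - k) : ℝ) : ℂ) := by
      rw [BoundedContinuousFunction.sub_apply, hFf, hG, BoundedContinuousFunction.sum_apply]
      simp only [rampComp_apply, sub_sub]
      push_cast
      rfl
    rw [hval, Complex.norm_real]
    exact abs_sub_sum_ramp_le hs0 hs1 (hf0 ω) (hfN ω)
  have h := norm_balanceDefect_le T x y (F - G)
  rw [map_sub, hG0, sub_zero] at h
  refine h.trans ?_
  have : 0 ≤ ‖T‖ * ‖x‖ * ‖y‖ := by positivity
  nlinarith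

theorem norm_balanceDefect_le_of_nonneg (hT : ∀ a b : C₀(Ω, ℂ), a * b = 0 → T a b = 0)
    (x y : C₀(Ω, ℂ)) (F : Ω →ᵇ ℂ) (f : C(Ω, ℝ)) (hFf : ∀ ω, F ω = (f ω : ℂ)) {N : ℕ}
    (hf0 : ∀ ω, 0 ≤ f ω) (hfN : ∀ ω, f ω ≤ N) :
    ‖balanceDefect T x y F‖ ≤ 4 * (‖T‖ * ‖x‖ * ‖y‖) := by
  let δ : ℝ → ℝ := fun r => Metric.infDist r (Set.range ((↑) : ℕ → ℝ))
  have hδ : Continuous δ := Metric.continuous_infDist_pt _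
  -- `g` is 0 within `1 / 8` of the naturals and 1 within `1 / 8` of the half-integers `k + 1 / 2`,
  -- so the two pieces of `x` suit staircases with `s = 0` and `s = 1 / 2`.
  let g : Ω → ℝ := fun ω => ramp (δ (f ω) - 1 / 4)
  have hg : Continuous g :=
    continuous_ramp.comp ((hδ.comp f.continuous).sub continuous_const)
  have hnear : ∀ ω (k : ℕ), |f ω - k| < 1 / 8 → g ω = 0 := by
    intro ω k hk
    have : δ (f ω) ≤ |f ω - k| := Metric.infDist_le_dist_of_mem ⟨k, rfl⟩
    exact max_eq_left ((min_le_right _ _).trans (by linarith))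
  have hfar : ∀ ω (k : ℕ), |f ω - 1 / 2 - k| < 1 / 8 → g ω = 1 := by
    intro ω k hk
    have : 3 / 8 ≤ δ (f ω) := by
      refine (Metric.le_infDist (Set.range_nonempty _)).2 ?_
      rintro _ ⟨m, rfl⟩
      rw [Real.dist_eq]
      rw [abs_lt] at hk
      rcases le_or_gt m k with h | h
      · have : (m : ℝ) ≤ k := by exact_mod_cast h
        exact le_abs.2 (Or.inl (by linarith))
      · have : (k : ℝ) + 1 ≤ m := by exact_mod_cast h
        exact le_abs.2 (Or.inr (by linarith))
    change max 0 (min 1 _) = (1 : ℝ)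
    rw [min_eq_left (by linarith), max_eq_right zero_le_one]
  let Φ : Ω →ᵇ ℂ := BoundedContinuousFunction.ofNormedAddCommGroup (fun ω => (g ω : ℂ))
    (Complex.continuous_ofReal.comp hg) 1
    (fun ω => by
      rw [Complex.norm_real, Real.norm_of_nonneg (ramp_nonneg _)]
      exact ramp_le_one _)
  have hΦ : ‖Φ‖ ≤ 1 := BoundedContinuousFunction.norm_ofNormedAddCommGroup_le _ zero_le_one _
  have hΦ' : ‖1 - Φ‖ ≤ 1 := by
    refine (BoundedContinuousFunction.norm_le zero_le_one).2 fun ω => ?_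
    have hval : (1 - Φ) ω = ((1 - g ω : ℝ) : ℂ) := by
      rw [Complex.ofReal_sub, Complex.ofReal_one]
      rfl
    rw [hval, Complex.norm_real, Real.norm_of_nonneg (sub_nonneg.2 (ramp_le_one _))]
    linarith [ramp_nonneg (δ (f ω) - 1 / 4)]
  have h1 := norm_balanceDefect_le_of_vanishing hT (boundedMul Φ x) y F f hFf hf0 hfN
    le_rfl zero_le_one fun ω k hk => by
      change (g ω : ℂ) * x ω = 0
      rw [hnear ω k (by simpa using hk), Complex.ofReal_zero, zero_mul]
  have h2 := norm_balanceDefect_le_of_vanishing hT (boundedMul (1 - Φ) x) y F f hFf hf0 hfN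
    (s := 1 / 2) (by norm_num) (by norm_num) fun ω k hk => by
      change (1 - (g ω : ℂ)) * x ω = 0
      rw [hfar ω k hk, Complex.ofReal_one, sub_self, zero_mul]
  have hsplit : balanceDefect T x y F = balanceDefect T (boundedMul Φ x) y F +
      balanceDefect T (boundedMul (1 - Φ) x) y F := by
    have hx : x = boundedMul Φ x + boundedMul (1 - Φ) x := by
      rw [← LinearMap.add_apply, ← map_add, add_sub_cancel, boundedMul_one]
    simp only [balanceDefect_apply]
    nth_rewrite 1 [hx]
    nth_rewrite 3 [hx]
    simp only [map_add, add_apply]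
    ring
  have hmono : ∀ Ψ : Ω →ᵇ ℂ, ‖Ψ‖ ≤ 1 → ‖T‖ * ‖boundedMul Ψ x‖ * ‖y‖ ≤ ‖T‖ * ‖x‖ * ‖y‖ := by
    intro Ψ hΨ
    gcongr
    exact (norm_boundedMul_le Ψ x).trans (mul_le_of_le_one_left (norm_nonneg _) hΨ)
  rw [hsplit]
  linarith [norm_add_le (balanceDefect T (boundedMul Φ x) y F)
    (balanceDefect T (boundedMul (1 - Φ) x) y F), hmono Φ hΦ, hmono (1 - Φ) hΦ']

theorem balanceDefect_one (T : DualOperator C₀(Ω, ℂ)) (x y : C₀(Ω, ℂ)) :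
    balanceDefect T x y 1 = 0 := by
  rw [balanceDefect_apply, boundedMul_one, boundedMul_one, sub_self]

theorem balanceDefect_eq_zero_of_real (hT : ∀ a b : C₀(Ω, ℂ), a * b = 0 → T a b = 0)
    (x y : C₀(Ω, ℂ)) (F : Ω →ᵇ ℂ) (f : C(Ω, ℝ)) (hFf : ∀ ω, F ω = (f ω : ℂ)) :
    balanceDefect T x y F = 0 := by
  have hfF : ∀ ω, |f ω| ≤ ‖F‖ := fun ω => by
    have := F.norm_coe_le_norm ω
    rwa [hFf, Complex.norm_real] at this
  -- Adding the constant `n * ‖F‖` makes `n * F` nonnegative without changing the defect, and the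
  -- bound does not grow with `n`.
  have hbound : ∀ n : ℕ, n * ‖balanceDefect T x y F‖ ≤ 4 * (‖T‖ * ‖x‖ * ‖y‖) := by
    intro n
    obtain ⟨N, hN⟩ := exists_nat_ge (2 * (n * ‖F‖))
    have h := norm_balanceDefect_le_of_nonneg hT x y
      ((n : ℂ) • F + ((n * ‖F‖ : ℝ) : ℂ) • (1 : Ω →ᵇ ℂ))
      ((n : ℝ) • f + ContinuousMap.const Ω (n * ‖F‖)) (N := N)
      (fun ω => by simp [hFf])
      (fun ω => by
        change 0 ≤ (n : ℝ) * f ω + n * ‖F‖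
        have := (abs_le.1 (hfF ω)).1
        nlinarith [(n.cast_nonneg : (0 : ℝ) ≤ n)])
      (fun ω => by
        change (n : ℝ) * f ω + n * ‖F‖ ≤ N
        have := (abs_le.1 (hfF ω)).2
        nlinarith [(n.cast_nonneg : (0 : ℝ) ≤ n)])
    rwa [map_add, map_smul, map_smul, balanceDefect_one, smul_zero, add_zero, norm_smul,
      Complex.norm_natCast] at h
  by_contra hne
  obtain ⟨n, hn⟩ := exists_nat_gt (4 * (‖T‖ * ‖x‖ * ‖y‖) / ‖balanceDefect T x y F‖)
  rw [div_lt_iff₀ (norm_pos_iff.2 hne)] at hn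
  exact hn.not_ge (hbound n)

/-- A bounded form vanishing on orthogonal pairs is balanced over bounded continuous functions. -/
theorem balanceDefect_eq_zero (hT : ∀ a b : C₀(Ω, ℂ), a * b = 0 → T a b = 0)
    (x y : C₀(Ω, ℂ)) (F : Ω →ᵇ ℂ) : balanceDefect T x y F = 0 := by
  let R : Ω →ᵇ ℂ := BoundedContinuousFunction.ofNormedAddCommGroup (fun ω => ((F ω).re : ℂ))
    (by have := F.continuous; fun_prop) ‖F‖
    (fun ω => by
      rw [Complex.norm_real]
      exact (Complex.abs_re_le_norm _).trans (F.norm_coe_le_norm ω))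
  let J : Ω →ᵇ ℂ := BoundedContinuousFunction.ofNormedAddCommGroup (fun ω => ((F ω).im : ℂ))
    (by have := F.continuous; fun_prop) ‖F‖
    (fun ω => by
      rw [Complex.norm_real]
      exact (Complex.abs_im_le_norm _).trans (F.norm_coe_le_norm ω))
  have hF : F = R + Complex.I • J := by
    ext ω
    change F ω = ((F ω).re : ℂ) + Complex.I * ((F ω).im : ℂ)
    rw [mul_comm, Complex.re_add_im]
  rw [hF, map_add, map_smul,
    balanceDefect_eq_zero_of_real hT x y R
      ⟨fun ω => (F ω).re, Complex.continuous_re.comp F.continuous⟩ fun _ => rfl,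
    balanceDefect_eq_zero_of_real hT x y J
      ⟨fun ω => (F ω).im, Complex.continuous_im.comp F.continuous⟩ fun _ => rfl,
    smul_zero, add_zero]

end HyperTauberian

end

theorem theoremT (Ω : Type*) [TopologicalSpace Ω] [WeaklyLocallyCompactSpace Ω] :
    HyperTauberian.IsHyperTauberian C₀(Ω, ℂ) := by
  refine ⟨HyperTauberian.isSemisimpleBanach_zeroAtInfty,
    HyperTauberian.isRegularBanach_zeroAtInfty, fun T hT a b => ?_⟩
  ext c
  have h := HyperTauberian.balanceDefect_eq_zero
    (fun _ _ hxy => HyperTauberian.apply_eq_zero_of_isLocal hT hxy) b c a.toBCF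
  rw [HyperTauberian.balanceDefect_apply, sub_eq_zero] at h
  have hc : HyperTauberian.boundedMul a.toBCF c = c * a := by
    ext ω
    exact mul_comm (a ω) (c ω)
  rw [hc] at h
  exact h
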